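/- **Setting.** Let $E$ be a complex Banach lattice, i.e. the complexification $E=E_{\mathbb R}+iE_{\mathbb R}$ of a real Banach lattice $E_{\mathbb R}$, with modulus $|x+iy|=\sup_{\theta\in\mathbb R}(\cos\theta\,x+\sin\theta\,y)$ and norm $\|z\|=\|\,|z|\,\|$. Its positive cone $E_+$ is that of $E_{\mathbb R}$, and $f>0$ means $f\in E_+$, $f\neq0$. Let $u\in E_+$ be a quasi-interior point, i.e. $E_u=\{f\in E:\exists c\ge 0,\ |f|\le cu\}$ is dense in $E$. For $f\in E_+$ write $f\gg_u0$ if $f\ge\varepsilon u$ for some $\varepsilon>0$; for a bounded linear operator $T$ on $E$ write $T\gg_u0$ if $Tf\gg_u0$ for every $f>0$. A functional $\varphi\in E'$ is strictly positive if $\langle\varphi,f\rangle>0$ for every $f>0$. Let $A:E\supseteq D(A)\to E$ be a densely defined linear operator which is real, i.e. $D(A)=(E_{\mathbb R}\cap D(A))+i(E_{\mathbb R}\cap D(A))$ and $A$ maps $E_{\mathbb R}\cap D(A)$ into $E_{\mathbb R}$. Let $\rho(A)$ and $\sigma(A)$ be its resolvent set and spectrum, $\mathcal R(\lambda,A)=(\lambda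 I-A)^{-1}$ its resolvent, and $A'$ its dual operator. Let $\lambda_0\in\sigma(A)\cap\mathbb R$ be a pole of $\mathcal R(\cdot,A)$, and let $P=\frac1{2\pi i}\oint\mathcal R(\lambda,A)\,d\lambda$ (over a small positively oriented circle around $\lambda_0$) be the corresponding spectral projection. The resolvent is called *individually eventually strongly positive with respect to $u$ at $\lambda_0$* if for every $f>0$ there is $\lambda_1>\lambda_0$ with $(\lambda_0,\lambda_1]\subseteq\rho(A)$ and $\mathcal R(\lambda,A)f\gg_u0$ for all $\lambda\in(\lambda_0,\lambda_1]$; it is called *individually eventually strongly negative with respect to $u$ at $\lambda_0$* if for every $f>0$ there is $\lambda_1<\lambda_0$ with $[\lambda_1,\lambda_0)\subseteq\rho(A)$ and $-\mathcal R(\lambda,A)f\gg_u0$ for all $\lambda\in[\lambda_1,\lambda_0)$. **Theorem.** 1. If $\mathcal R(\cdot,A)$ is individually eventually strongly positive or individually eventually strongly negative with respect to $u$ at $\lambda_0$, then $P\gg_u0$. 2. The conclusion $P\gg_u0$ is equivalent to the following: the eigenvalue $\lambda_0$ of $A$ is geometrically simple, $\ker(\lambda_0I-A)$ contains a vector $v\gg_u0$,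 and $\ker(\lambda_0I-A')$ contains a strictly positive functional. -/

import Mathlib

open Complex Set Filter Topology

/-- `E` is a complex Banach lattice with real part the real Banach lattice `F`: as a complex vector
space, `E` is the complexification `F + iF`; the modulus of `z = x + iy` is
`|z| = sup_θ (cos θ x + sin θ y)`; and the norm of `E` is `‖z‖ = ‖|z|‖`. -/
class ComplexBanachLattice (F E : Type*)
    [NormedAddCommGroup F] [NormedSpace ℝ F] [Lattice F]
    [NormedAddCommGroup E] [NormedSpace ℂ E] where
  /-- The embedding of the real part. -/
  ofReal : F →ₗ[ℝ] E
  /-- Every vector is uniquely of the form `x + iy` with `x`, `y` in the real part. -/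
  existsUnique_re_im : ∀ z : E, ∃! p : F × F, z = ofReal p.1 + I • ofReal p.2
  /-- The modulus, with values in the real part. -/
  modulus : E → F
  isLUB_modulus : ∀ x y : F,
    IsLUB (Set.range fun θ : ℝ => Real.cos θ • x + Real.sin θ • y)
      (modulus (ofReal x + I • ofReal y))
  norm_eq : ∀ z : E, ‖z‖ = ‖modulus z‖

namespace ComplexBanachLattice

variable (F : Type*) {E : Type*}
  [NormedAddCommGroup F] [NormedSpace ℝ F] [Lattice F]
  [NormedAddCommGroup E] [NormedSpace ℂ E] [ComplexBanachLattice F E]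

/-- The real part `E_ℝ` of `E`, as a real subspace of `E`. -/
noncomputable def realPart (E : Type*) [NormedAddCommGroup E] [NormedSpace ℂ E] [ComplexBanachLattice F E] :
    Submodule ℝ E :=
  LinearMap.range (ofReal : F →ₗ[ℝ] E)

variable {F}

/-- The principal ideal `E_u = {f ∈ E : ∃ c ≥ 0, |f| ≤ c u}`. -/
def principalIdeal (E : Type*) [NormedAddCommGroup E] [NormedSpace ℂ E]
    [ComplexBanachLattice F E] (u : F) : Set E :=
  {f : E | ∃ c : ℝ, 0 ≤ c ∧ modulus f ≤ c • u}

/-- `u` is a quasi-interior point of the positive cone `E_+` (which lies in the real part). -/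
def IsQuasiInterior (E : Type*) [NormedAddCommGroup E] [NormedSpace ℂ E]
    [ComplexBanachLattice F E] (u : F) : Prop :=
  0 ≤ u ∧ Dense (principalIdeal E u)

/-- `f ≫_u 0`: the vector `f` belongs to `E_+`, and `f ≥ ε u` for some `ε > 0`. -/
def StronglyPositive (u : F) (f : E) : Prop :=
  ∃ x : F, ofReal x = f ∧ 0 ≤ x ∧ ∃ ε : ℝ, 0 < ε ∧ ε • u ≤ x

/-- `T ≫_u 0`: `T f ≫_u 0` for every `f > 0`. -/
def OpStronglyPositive (u : F) (T : E →L[ℂ] E) : Prop :=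
  ∀ x : F, 0 < x → StronglyPositive u (T (ofReal x))

variable (F) in
/-- A strictly positive functional: `⟨φ, f⟩` is a real number `> 0` for every `f > 0`. -/
def StrictlyPositive (φ : E →L[ℂ] ℂ) : Prop :=
  ∀ x : F, 0 < x → ∃ r : ℝ, 0 < r ∧ φ (ofReal x) = (r : ℂ)

end ComplexBanachLattice

/-! ### Unbounded operators: resolvent, poles, spectral projection, dual operator -/

namespace UnboundedOp

variable {E : Type*} [NormedAddCommGroup E] [NormedSpace ℂ E]

/-- `R` is a bounded two-sided inverse of `z I - A : D(A) → E`. -/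
def IsResolventAt (A : E →ₗ.[ℂ] E) (z : ℂ) (R : E →L[ℂ] E) : Prop :=
  (∀ f : E, ∃ h : R f ∈ A.domain, z • R f - A ⟨R f, h⟩ = f) ∧
    ∀ x : A.domain, R (z • (x : E) - A x) = x

/-- The resolvent set. -/
def resolventSet (A : E →ₗ.[ℂ] E) : Set ℂ :=
  {z : ℂ | ∃ R : E →L[ℂ] E, IsResolventAt A z R}

/-- The spectrum. -/
def spectrum (A : E →ₗ.[ℂ] E) : Set ℂ :=
  (resolventSet A)ᶜ

open Classical in
/-- The resolvent `(z I - A)⁻¹`, set to `0` outside the resolvent set. -/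
noncomputable def resolvent (A : E →ₗ.[ℂ] E) (z : ℂ) : E →L[ℂ] E :=
  if h : z ∈ resolventSet A then h.choose else 0

theorem IsResolventAt.unique {A : E →ₗ.[ℂ] E} {z : ℂ} {R S : E →L[ℂ] E}
    (hR : IsResolventAt A z R) (hS : IsResolventAt A z S) : R = S := by
  ext f
  obtain ⟨h, hf⟩ := hR.1 f
  have := hS.2 ⟨R f, h⟩
  simp only [hf] at this
  exact this.symm

theorem isResolventAt_resolvent {A : E →ₗ.[ℂ] E} {z : ℂ} (h : z ∈ resolventSet A) :
    IsResolventAt A z (resolvent A z) := by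
  rw [resolvent, dif_pos h]
  exact h.choose_spec

/-- `z₀` is a pole of the resolvent: an isolated singularity of the resolvent (a punctured
neighbourhood of `z₀` lies in the resolvent set) at which the resolvent is meromorphic, of
negative order. -/
def IsPoleOfResolvent (A : E →ₗ.[ℂ] E) (z₀ : ℂ) : Prop :=
  (∀ᶠ z in 𝓝[≠] z₀, z ∈ resolventSet A) ∧
    MeromorphicAt (resolvent A) z₀ ∧ meromorphicOrderAt (resolvent A) z₀ < 0

/-- `P` is the spectral projection associated with the isolated point `z₀`:
`P = (2πi)⁻¹ ∮ (z I - A)⁻¹ dz` over a circle around `z₀` whose closed disc, `z₀` excepted, lies in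
the resolvent set. -/
def IsSpectralProjection (A : E →ₗ.[ℂ] E) (z₀ : ℂ) (P : E →L[ℂ] E) : Prop :=
  ∃ r : ℝ, 0 < r ∧ Metric.closedBall z₀ r \ {z₀} ⊆ resolventSet A ∧
    P = (2 * (Real.pi : ℂ) * I)⁻¹ • ∮ z in C(z₀, r), resolvent A z

/-- The eigenspace `ker (z I - A) ⊆ D(A)`, as a subspace of `E`. -/
def eigenspace (A : E →ₗ.[ℂ] E) (z : ℂ) : Submodule ℂ E :=
  (LinearMap.ker (z • A.domain.subtype - A.toFun)).map A.domain.subtype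

/-- The graph of the dual operator: all `(φ, ψ)` with `⟨φ, A x⟩ = ⟨ψ, x⟩` for `x ∈ D(A)`. -/
def dualGraph (A : E →ₗ.[ℂ] E) : Submodule ℂ ((E →L[ℂ] ℂ) × (E →L[ℂ] ℂ)) where
  carrier := {p | ∀ x : A.domain, p.1 (A x) = p.2 x}
  add_mem' := by
    intro a b ha hb x
    change ∀ x : A.domain, _ at ha
    change ∀ x : A.domain, _ at hb
    simp [ha x, hb x]
  zero_mem' := by
    intro x
    simp
  smul_mem' := by
    intro c a ha x
    change ∀ x : A.domain, _ at ha
    simp [ha x]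

/-- The dual operator `A' : E' ⊇ D(A') → E'` of a densely defined operator `A`. -/
noncomputable def dual (A : E →ₗ.[ℂ] E) : (E →L[ℂ] ℂ) →ₗ.[ℂ] (E →L[ℂ] ℂ) :=
  (dualGraph A).toLinearPMap

theorem dual_graph {A : E →ₗ.[ℂ] E} (hA : Dense (A.domain : Set E)) :
    (dual A).graph = dualGraph A := by
  refine Submodule.toLinearPMap_graph_eq _ ?_
  rintro ⟨φ, ψ⟩ h h0
  simp only at h0
  subst h0
  have hfun : (ψ : E → ℂ) = fun _ => 0 := by
    refine Continuous.ext_on hA ψ.continuous continuous_const ?_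
    intro x hx
    simpa using (h ⟨x, hx⟩).symm
  exact ContinuousLinearMap.ext fun x => congrFun hfun x

section Lattice

open ComplexBanachLattice

variable (F : Type*) [NormedAddCommGroup F] [NormedSpace ℝ F] [Lattice F]
  [ComplexBanachLattice F E]

/-- `A` is real: `D(A) = (E_ℝ ∩ D(A)) + i (E_ℝ ∩ D(A))`, and `A` maps `E_ℝ ∩ D(A)` to `E_ℝ`. -/
def IsRealOp (A : E →ₗ.[ℂ] E) : Prop :=
  (∀ z : E, z ∈ A.domain ↔
    ∃ a ∈ realPart F E, ∃ b ∈ realPart F E, a ∈ A.domain ∧ b ∈ A.domain ∧ z = a + I • b) ∧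
  ∀ x : A.domain, (x : E) ∈ realPart F E → A x ∈ realPart F E

variable {F}

/-- The resolvent is individually eventually strongly positive with respect to `u` at `l₀`. -/
def ResolventEventuallyStronglyPositive (A : E →ₗ.[ℂ] E) (u : F) (l₀ : ℝ) : Prop :=
  ∀ x : F, 0 < x → ∃ l₁ : ℝ, l₀ < l₁ ∧ ∀ l ∈ Set.Ioc l₀ l₁,
    (l : ℂ) ∈ resolventSet A ∧ StronglyPositive u (resolvent A (l : ℂ) (ofReal x))

/-- The resolvent is individually eventually strongly negative with respect to `u` at `l₀`. -/
def ResolventEventuallyStronglyNegative (A : E →ₗ.[ℂ] E) (u : F) (l₀ : ℝ) : Prop :=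
  ∀ x : F, 0 < x → ∃ l₁ : ℝ, l₁ < l₀ ∧ ∀ l ∈ Set.Ico l₁ l₀,
    (l : ℂ) ∈ resolventSet A ∧ StronglyPositive u (-(resolvent A (l : ℂ) (ofReal x)))

/-- The Perron-Frobenius property: `l₀` is a geometrically simple eigenvalue of `A`,
`ker (l₀ I - A)` contains a vector `v ≫_u 0`, and `ker (l₀ I - A')` contains a strictly positive
functional. -/
def PerronFrobenius (A : E →ₗ.[ℂ] E) (u : F) (l₀ : ℝ) : Prop :=
  Module.finrank ℂ (eigenspace A (l₀ : ℂ)) = 1 ∧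
  (∃ v ∈ eigenspace A (l₀ : ℂ), StronglyPositive u v) ∧
  ∃ φ ∈ eigenspace (dual A) (l₀ : ℂ), StrictlyPositive F φ

end Lattice

end UnboundedOp

/-!
The two parts of the theorem rest on the leading Laurent coefficient `Q = lim (z - λ₀)ᵐ R(z)` of the
resolvent at the pole `λ₀` of order `m ≥ 1`. It is nonzero, its range lies in `ker (λ₀ - A)`, and it
commutes with the resolvent, and `(w - λ₀) R(w) Q = Q = (w - λ₀) Q R(w)`. At a simple pole it is
the spectral projection `P`, by Cauchy's formula.

*Eventual positivity implies `P ≫ 0`.* Up to a sign, `Q` is a limit of operators that are eventually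
positive on each vector, so `Q` is positive. A nonzero vector `Q x`, `x ≥ 0`, is an eigenvector of
the resolvents, which forces `Q x ≫ 0`. Since `u` is quasi-interior and `Q ≠ 0`, one has `Q u ≠ 0`.
For `f > 0` the identity `Q f = (w - λ₀) Q R(w) f` bounds `Q f` below by a multiple of `Q u ≫ 0`;
hence `Q ≫ 0`. A pole of higher order would give `Q² = 0`, so the pole is simple and `P = Q`
(`opStronglyPositive_of_tendsto`, `opStronglyPositive_of_sign`).

*The Perron–Frobenius property implies `P ≫ 0`.* If `φ` is a strictly positive dual eigenvector and
the pole is not simple, then `φ ∘ Q = 0`; but the range of `Q` is contained in the span of `v ≫ 0`,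
and `φ(v) > 0`. So the pole is simple, `P = Q`, and `P f = (φ(f) / φ(v)) v`.

*`P ≫ 0` implies the Perron–Frobenius property.* The operator `P` is a projection
(`IsSpectralProjection.mul_self`) which is the identity on `ker (λ₀ - A)`. Its real fixed space is a
sublattice without disjoint positive vectors, so it is totally ordered, and an Archimedean totally
ordered space is at most one-dimensional (`exists_eq_smul_of_fixed`). Hence `P = φ ⊗ v`, and `φ` and
`v` are the eigenvectors sought.
-/

namespace UnboundedOp

variable {E : Type*} [NormedAddCommGroup E] [NormedSpace ℂ E] {A : E →ₗ.[ℂ] E} {z w z₀ : ℂ}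

/-! ### The resolvent identity and analyticity of the resolvent -/

theorem mem_eigenspace_iff {x : E} :
    x ∈ eigenspace A z ↔ ∃ h : x ∈ A.domain, A ⟨x, h⟩ = z • x := by
  simp only [eigenspace, Submodule.mem_map, LinearMap.mem_ker, LinearMap.sub_apply,
    LinearMap.smul_apply, Submodule.subtype_apply, sub_eq_zero, LinearPMap.toFun_eq_coe]
  constructor
  · rintro ⟨y, hy, rfl⟩
    exact ⟨y.2, hy.symm⟩
  · rintro ⟨h, hx⟩
    exact ⟨⟨x, h⟩, hx.symm, rfl⟩

theorem mem_eigenspace_iff_resolvent (hw : w ∈ resolventSet A) {x : E} :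
    x ∈ eigenspace A z ↔ (w - z) • resolvent A w x = x := by
  have hR := isResolventAt_resolvent hw
  rw [mem_eigenspace_iff]
  constructor
  · rintro ⟨h, hx⟩
    have := hR.2 ⟨x, h⟩
    rwa [hx, ← sub_smul, map_smul] at this
  · intro hx
    obtain ⟨h, hh⟩ := hR.1 ((w - z) • x)
    have hval : resolvent A w ((w - z) • x) = x := by rw [map_smul, hx]
    have hd : x ∈ A.domain := by rwa [hval] at h
    have hsub : (⟨_, h⟩ : A.domain) = ⟨x, hd⟩ := Subtype.ext hval
    refine ⟨hd, ?_⟩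
    rw [hsub, hval, sub_smul] at hh
    exact sub_right_injective hh

theorem resolvent_apply_of_mem_eigenspace (hw : w ∈ resolventSet A) (hwz : w ≠ z) {x : E}
    (hx : x ∈ eigenspace A z) : resolvent A w x = (w - z)⁻¹ • x :=
  (eq_inv_smul_iff₀ (sub_ne_zero.2 hwz)).2 ((mem_eigenspace_iff_resolvent hw).1 hx)

/-- The resolvent identity. -/
theorem resolvent_sub_resolvent (hw : w ∈ resolventSet A) (hz : z ∈ resolventSet A) :
    resolvent A w - resolvent A z = (z - w) • (resolvent A w * resolvent A z) := by
  ext f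
  obtain ⟨h, hh⟩ := (isResolventAt_resolvent hz).1 f
  have := (isResolventAt_resolvent hw).2 ⟨_, h⟩
  calc resolvent A w f - resolvent A z f
      = resolvent A w f - resolvent A w (w • resolvent A z f - A ⟨_, h⟩) := by rw [this]
    _ = resolvent A w ((z - w) • resolvent A z f) := by
      rw [← map_sub]
      congr 1
      nth_rewrite 1 [← hh]
      rw [sub_smul]
      abel
    _ = _ := map_smul _ _ _

theorem resolvent_mul_comm (hw : w ∈ resolventSet A) (hz : z ∈ resolventSet A) :
    resolvent A w * resolvent A z = resolvent A z * resolvent A w := by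
  rcases eq_or_ne w z with rfl | hne
  · rfl
  have h1 := resolvent_sub_resolvent hw hz
  have h2 := resolvent_sub_resolvent hz hw
  rw [← neg_sub (resolvent A w), h1, ← neg_sub z w, neg_smul, neg_inj] at h2
  exact smul_right_injective _ (sub_ne_zero.2 hne.symm) h2

/-- On the resolvent set the resolvent is locally bounded, since `‖R(z)‖ ≤ 2 ‖R(w)‖` as soon as
`|z - w| ‖R(w)‖ ≤ 1 / 2`; with the resolvent identity this yields continuity. -/
theorem continuousOn_resolvent : ContinuousOn (resolvent A) (resolventSet A) := by
  intro w hw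
  have hsmall : Tendsto (fun z : ℂ => ‖z - w‖ * ‖resolvent A w‖) (𝓝[resolventSet A] w) (𝓝 0) := by
    have : Continuous fun z : ℂ => ‖z - w‖ * ‖resolvent A w‖ := by fun_prop
    simpa using (this.tendsto w).mono_left nhdsWithin_le_nhds
  have hlim : Tendsto (fun z : ℂ => ‖z - w‖ * ‖resolvent A w‖ * (2 * ‖resolvent A w‖))
      (𝓝[resolventSet A] w) (𝓝 0) := by
    simpa using hsmall.mul_const (2 * ‖resolvent A w‖)
  rw [ContinuousWithinAt, tendsto_iff_norm_sub_tendsto_zero]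
  refine squeeze_zero' (Eventually.of_forall fun _ => norm_nonneg _) ?_ hlim
  filter_upwards [self_mem_nhdsWithin, hsmall.eventually_le_const (u := 1 / 2) (by norm_num)]
    with z hz hz2
  have hdiff : ‖resolvent A z - resolvent A w‖ ≤
      ‖z - w‖ * ‖resolvent A w‖ * ‖resolvent A z‖ := by
    rw [resolvent_sub_resolvent hz hw, norm_smul, norm_sub_rev w z, mul_assoc,
      mul_comm ‖resolvent A w‖]
    gcongr
    exact norm_mul_le _ _
  have hbound : ‖resolvent A z‖ ≤ 2 * ‖resolvent A w‖ := by
    have h1 := norm_sub_norm_le (resolvent A z) (resolvent A w)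
    have h2 := mul_le_mul_of_nonneg_right hz2 (norm_nonneg (resolvent A z))
    linarith
  exact hdiff.trans (by gcongr)

theorem differentiableAt_resolvent (w : ℂ) (hw : w ∈ interior (resolventSet A)) :
    DifferentiableAt ℂ (resolvent A) w := by
  have hmem : resolventSet A ∈ 𝓝 w := mem_interior_iff_mem_nhds.1 hw
  have hcont : ContinuousAt (resolvent A) w := continuousOn_resolvent.continuousAt hmem
  refine HasDerivAt.differentiableAt (f' := -(resolvent A w * resolvent A w)) ?_
  rw [hasDerivAt_iff_tendsto_slope]
  have hlim : Tendsto (fun z => -(resolvent A z * resolvent A w)) (𝓝[≠] w)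
      (𝓝 (-(resolvent A w * resolvent A w))) :=
    ((hcont.tendsto.mul_const _).neg).mono_left nhdsWithin_le_nhds
  refine hlim.congr' ?_
  filter_upwards [self_mem_nhdsWithin, nhdsWithin_le_nhds hmem] with z hne hz
  rw [slope_def_module, resolvent_sub_resolvent hz (mem_of_mem_nhds hmem), smul_smul,
    ← neg_sub z w, mul_neg, inv_mul_cancel₀ (sub_ne_zero.2 hne), neg_one_smul]

/-! ### Eigenvectors of the dual operator -/

theorem mem_eigenspace_dual_iff (hA : Dense (A.domain : Set E)) {φ : E →L[ℂ] ℂ} :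
    φ ∈ eigenspace (dual A) z ↔ ∀ x : A.domain, φ (A x) = z • φ x := by
  rw [mem_eigenspace_iff]
  have hg : (φ, z • φ) ∈ (dual A).graph ↔ ∀ x : A.domain, φ (A x) = z • φ x := by
    rw [dual_graph hA]
    rfl
  rw [← hg, LinearPMap.mem_graph_iff]
  constructor
  · rintro ⟨h, hx⟩
    exact ⟨⟨φ, h⟩, rfl, hx⟩
  · rintro ⟨y, rfl, hy⟩
    exact ⟨y.2, hy⟩

/-! ### The leading Laurent coefficient -/

/-- At a pole of order `m + 1` the limit `Q` of `(z - z₀) ^ (m + 1) R(z)` exists and is nonzero. -/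
theorem IsPoleOfResolvent.exists_leadingCoeff (h : IsPoleOfResolvent A z₀) :
    ∃ (m : ℕ) (Q : E →L[ℂ] E), Q ≠ 0 ∧
      Tendsto (fun z => (z - z₀) ^ (m + 1) • resolvent A z) (𝓝[≠] z₀) (𝓝 Q) := by
  obtain ⟨-, hmero, hneg⟩ := h
  obtain ⟨n, hn⟩ := WithTop.ne_top_iff_exists.1 hneg.ne_top
  rw [← hn] at hneg
  have hn0 : n < 0 := by exact_mod_cast hneg
  obtain ⟨g, hg, hg0, hev⟩ := (meromorphicOrderAt_eq_int_iff hmero).1 hn.symm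
  obtain ⟨m, rfl⟩ : ∃ m : ℕ, n = -((m + 1 : ℕ) : ℤ) := ⟨(-n - 1).toNat, by omega⟩
  refine ⟨m, g z₀, hg0, (hg.continuousAt.tendsto.mono_left nhdsWithin_le_nhds).congr' ?_⟩
  filter_upwards [hev, self_mem_nhdsWithin] with z hz hne
  rw [hz, zpow_neg, zpow_natCast, smul_inv_smul₀ (pow_ne_zero _ (sub_ne_zero.2 hne))]

theorem IsPoleOfResolvent.nontrivial {z₀ : ℂ} (h : IsPoleOfResolvent A z₀) : Nontrivial E := by
  obtain ⟨m, Q, hQ0, -⟩ := h.exists_leadingCoeff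
  obtain ⟨f, hf⟩ := DFunLike.ne_iff.1 hQ0
  exact ⟨⟨_, _, hf⟩⟩

section Leading

variable {m : ℕ} {Q : E →L[ℂ] E}

theorem resolvent_mul_leadingCoeff (hρ : ∀ᶠ z in 𝓝[≠] z₀, z ∈ resolventSet A)
    (hQ : Tendsto (fun z => (z - z₀) ^ (m + 1) • resolvent A z) (𝓝[≠] z₀) (𝓝 Q))
    (hw : w ∈ resolventSet A) :
    (w - z₀) • (resolvent A w * Q) = Q := by
  have hpow : Tendsto (fun z : ℂ => (z - z₀) ^ (m + 1)) (𝓝[≠] z₀) (𝓝 0) := by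
    have : Continuous fun z : ℂ => (z - z₀) ^ (m + 1) := by fun_prop
    simpa using (this.tendsto z₀).mono_left nhdsWithin_le_nhds
  have hid : Tendsto (fun z : ℂ => w - z) (𝓝[≠] z₀) (𝓝 (w - z₀)) :=
    ((continuous_const.sub continuous_id).tendsto z₀).mono_left nhdsWithin_le_nhds
  have h1 := hid.smul (hQ.const_mul (resolvent A w))
  have h2 := hQ.sub (hpow.smul_const (resolvent A w))
  rw [zero_smul, sub_zero] at h2
  refine tendsto_nhds_unique h1 (h2.congr' ?_)
  filter_upwards [hρ] with z hz
  rw [← smul_sub, resolvent_sub_resolvent hz hw, mul_smul_comm, resolvent_mul_comm hz hw,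
    smul_comm]

theorem leadingCoeff_mul_resolvent (hρ : ∀ᶠ z in 𝓝[≠] z₀, z ∈ resolventSet A)
    (hQ : Tendsto (fun z => (z - z₀) ^ (m + 1) • resolvent A z) (𝓝[≠] z₀) (𝓝 Q))
    (hw : w ∈ resolventSet A) :
    (w - z₀) • (Q * resolvent A w) = Q := by
  have hcomm : Q * resolvent A w = resolvent A w * Q := by
    refine tendsto_nhds_unique (hQ.mul_const (resolvent A w))
      ((hQ.const_mul (resolvent A w)).congr' ?_)
    filter_upwards [hρ] with z hz
    rw [mul_smul_comm, smul_mul_assoc, resolvent_mul_comm hz hw]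
  rw [hcomm, resolvent_mul_leadingCoeff hρ hQ hw]

theorem leadingCoeff_mem_eigenspace (hρ : ∀ᶠ z in 𝓝[≠] z₀, z ∈ resolventSet A)
    (hQ : Tendsto (fun z => (z - z₀) ^ (m + 1) • resolvent A z) (𝓝[≠] z₀) (𝓝 Q)) (f : E) :
    Q f ∈ eigenspace A z₀ := by
  obtain ⟨w, hw⟩ := hρ.exists
  rw [mem_eigenspace_iff_resolvent hw]
  exact congr($(resolvent_mul_leadingCoeff hρ hQ hw) f)

end Leading

/-! ### The spectral projection -/

variable {r : ℝ} {P : E →L[ℂ] E}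

theorem _root_.ContinuousLinearMap.circleIntegral_comp_comm {G H : Type*} [NormedAddCommGroup G]
    [NormedSpace ℂ G] [CompleteSpace G] [NormedAddCommGroup H] [NormedSpace ℂ H] [CompleteSpace H]
    (L : G →L[ℂ] H) {f : ℂ → G} {c : ℂ} {r : ℝ} (hf : CircleIntegrable f c r) :
    (∮ z in C(c, r), L (f z)) = L (∮ z in C(c, r), f z) := by
  simp only [circleIntegral]
  rw [← L.intervalIntegral_comp_comm hf.out]
  simp

theorem sphere_subset_closedBall_diff_singleton {c : ℂ} (hr : 0 < r) :
    Metric.sphere c r ⊆ Metric.closedBall c r \ {c} := fun z hz =>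
  ⟨Metric.sphere_subset_closedBall hz, fun h => by
    rw [mem_singleton_iff.1 h, Metric.mem_sphere, dist_self] at hz
    exact hr.ne hz⟩

theorem ball_diff_singleton_subset_interior {c : ℂ} {S : Set ℂ}
    (h : Metric.closedBall c r \ {c} ⊆ S) : Metric.ball c r \ {c} ⊆ interior S :=
  interior_maximal ((sdiff_subset_sdiff_left Metric.ball_subset_closedBall).trans h)
    (Metric.isOpen_ball.sdiff isClosed_singleton)

theorem circleIntegrable_resolvent (hr : 0 < r)
    (h : Metric.closedBall z₀ r \ {z₀} ⊆ resolventSet A) :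
    CircleIntegrable (resolvent A) z₀ r :=
  (continuousOn_resolvent.mono
    ((sphere_subset_closedBall_diff_singleton hr).trans h)).circleIntegrable hr.le

theorem two_pi_I_inv_smul_circleIntegral_sub_inv (c w : ℂ) {V : Type*} [NormedAddCommGroup V]
    [NormedSpace ℂ V] [CompleteSpace V] (hw : w ∈ Metric.ball c r) (v : V) :
    (2 * (Real.pi : ℂ) * I)⁻¹ • (∮ z in C(c, r), (z - w)⁻¹ • v) = v := by
  rw [circleIntegral.integral_smul_const, circleIntegral.integral_sub_inv_of_mem_ball hw,
    inv_smul_smul₀ two_pi_I_ne_zero]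

variable [CompleteSpace E]

theorem IsSpectralProjection.apply_of_mem_eigenspace (hP : IsSpectralProjection A z₀ P) {x : E}
    (hx : x ∈ eigenspace A z₀) : P x = x := by
  obtain ⟨r, hr, hsub, rfl⟩ := hP
  rw [smul_apply]
  have := (ContinuousLinearMap.apply ℂ E x).circleIntegral_comp_comm
    (circleIntegrable_resolvent hr hsub)
  simp only [ContinuousLinearMap.apply_apply] at this
  rw [← this, circleIntegral.integral_congr hr.le (g := fun z => (z - z₀)⁻¹ • x),
    two_pi_I_inv_smul_circleIntegral_sub_inv _ _ (Metric.mem_ball_self hr)]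
  intro z hz
  have hz' := sphere_subset_closedBall_diff_singleton hr hz
  exact resolvent_apply_of_mem_eigenspace (hsub hz') hz'.2 hx

theorem IsSpectralProjection.resolvent_mul_comm (hP : IsSpectralProjection A z₀ P)
    (hw : w ∈ resolventSet A) : resolvent A w * P = P * resolvent A w := by
  obtain ⟨r, hr, hsub, rfl⟩ := hP
  have hint := circleIntegrable_resolvent hr hsub
  have h1 := (ContinuousLinearMap.mul ℂ (E →L[ℂ] E) (resolvent A w)).circleIntegral_comp_comm hint
  have h2 := ((ContinuousLinearMap.mul ℂ (E →L[ℂ] E)).flip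
    (resolvent A w)).circleIntegral_comp_comm hint
  simp only [ContinuousLinearMap.mul_apply', ContinuousLinearMap.flip_apply] at h1 h2
  rw [mul_smul_comm, smul_mul_assoc, ← h1, ← h2]
  congr 1
  exact circleIntegral.integral_congr hr.le fun z hz =>
    UnboundedOp.resolvent_mul_comm hw (hsub (sphere_subset_closedBall_diff_singleton hr hz))

/-- At a simple pole the spectral projection is the leading coefficient. -/
theorem IsSpectralProjection.eq_of_tendsto (hP : IsSpectralProjection A z₀ P) {Q : E →L[ℂ] E}
    (hQ : Tendsto (fun z => (z - z₀) • resolvent A z) (𝓝[≠] z₀) (𝓝 Q)) : P = Q := by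
  obtain ⟨r, hr, hsub, rfl⟩ := hP
  have key :=
    circleIntegral_sub_center_inv_smul_of_differentiable_on_off_countable_of_tendsto
    (f := fun z => (z - z₀) • resolvent A z) hr countable_empty
    ((continuousOn_id.sub continuousOn_const).smul (continuousOn_resolvent.mono hsub))
    (fun z hz => ((differentiableAt_id.sub_const _).smul (differentiableAt_resolvent z
      (ball_diff_singleton_subset_interior hsub
        ⟨hz.1.1, hz.1.2⟩)))) hQ
  rw [circleIntegral.integral_congr hr.le (g := resolvent A)] at key
  · rw [key, inv_smul_smul₀ two_pi_I_ne_zero]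
  · intro z hz
    exact inv_smul_smul₀ (sub_ne_zero.2 (sphere_subset_closedBall_diff_singleton hr hz).2) _

/-- The spectral projection is idempotent: by the resolvent identity `R(w) (1 - P)` agrees near `z₀`
with the Cauchy integral of the resolvent, which is holomorphic in the whole disc, so that its
integral `P (1 - P)` vanishes. -/
theorem IsSpectralProjection.mul_self (hP : IsSpectralProjection A z₀ P) : P * P = P := by
  obtain ⟨r, hr, hsub, hPr⟩ := hP
  have hint := circleIntegrable_resolvent hr hsub
  lift r to NNReal using hr.le
  have hball := (hasFPowerSeriesOn_cauchy_integral hint (by exact_mod_cast hr)).differentiableOn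
  set h : ℂ → (E →L[ℂ] E) := fun w =>
    (2 * (Real.pi : ℂ) * I)⁻¹ • ∮ z in C(z₀, r), (z - w)⁻¹ • resolvent A z with hh
  rw [Metric.eball_coe] at hball
  have hkey : ∀ w ∈ Metric.ball z₀ r \ {z₀}, resolvent A w * (1 - P) = h w := by
    intro w hw
    have hwρ : w ∈ resolventSet A := hsub ⟨Metric.ball_subset_closedBall hw.1, hw.2⟩
    have hne : ∀ z ∈ Metric.sphere z₀ (r : ℝ), z - w ≠ 0 := fun z hz h0 => by
      rw [sub_eq_zero] at h0
      subst h0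
      exact (Metric.mem_ball.1 hw.1).ne (Metric.mem_sphere.1 hz)
    have hinv : ContinuousOn (fun z : ℂ => (z - w)⁻¹) (Metric.sphere z₀ (r : ℝ)) :=
      (continuousOn_id.sub continuousOn_const).inv₀ hne
    have h1 := (ContinuousLinearMap.mul ℂ (E →L[ℂ] E) (resolvent A w)).circleIntegral_comp_comm hint
    simp only [ContinuousLinearMap.mul_apply'] at h1
    have h2 : resolvent A w * P = resolvent A w - h w := by
      rw [hPr, mul_smul_comm, ← h1, hh, circleIntegral.integral_congr hr.le
        (g := fun z => (z - w)⁻¹ • resolvent A w - (z - w)⁻¹ • resolvent A z),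
        circleIntegral.integral_sub, smul_sub,
        two_pi_I_inv_smul_circleIntegral_sub_inv _ _ hw.1]
      · exact (hinv.smul continuousOn_const).circleIntegrable hr.le
      · exact (hinv.smul (continuousOn_resolvent.mono
          ((sphere_subset_closedBall_diff_singleton hr).trans hsub))).circleIntegrable hr.le
      · intro z hz
        simp only
        rw [← smul_sub, resolvent_sub_resolvent hwρ
          (hsub (sphere_subset_closedBall_diff_singleton hr hz)),
          inv_smul_smul₀ (hne z hz)]
    rw [mul_sub, mul_one, h2, sub_sub_cancel]
  -- The integral is independent of the radius; halving it moves the circle into the open disc.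
  have hs : (0 : ℝ) < r / 2 := by positivity
  have hsr : (r : ℝ) / 2 < r := half_lt_self hr
  have hPs : P = (2 * (Real.pi : ℂ) * I)⁻¹ • ∮ z in C(z₀, (r : ℝ) / 2), resolvent A z := by
    rw [hPr, Complex.circleIntegral_eq_of_differentiable_on_annulus_off_countable hs hsr.le
      countable_empty]
    · refine continuousOn_resolvent.mono (Subset.trans ?_ hsub)
      exact sdiff_subset_sdiff_right (singleton_subset_iff.2 (Metric.mem_ball_self hs))
    · intro z hz
      refine differentiableAt_resolvent z (ball_diff_singleton_subset_interior hsub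
        ⟨hz.1.1, fun hz0 => hz.1.2 ?_⟩)
      rw [mem_singleton_iff.1 hz0]
      exact Metric.mem_closedBall_self hs.le
  have hsub' : Metric.closedBall z₀ ((r : ℝ) / 2) ⊆ Metric.ball z₀ r :=
    Metric.closedBall_subset_ball hsr
  have hzero : (∮ z in C(z₀, (r : ℝ) / 2), h z) = 0 :=
    ((hball.mono hsub').diffContOnCl_ball Subset.rfl).circleIntegral_eq_zero hs.le
  have hint' : CircleIntegrable (resolvent A) z₀ ((r : ℝ) / 2) :=
    circleIntegrable_resolvent hs
      ((sdiff_subset_sdiff_left (Metric.closedBall_subset_closedBall hsr.le)).trans hsub)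
  have h3 := ((ContinuousLinearMap.mul ℂ (E →L[ℂ] E)).flip (1 - P)).circleIntegral_comp_comm hint'
  simp only [ContinuousLinearMap.mul_apply', ContinuousLinearMap.flip_apply] at h3
  have h4 : P * (1 - P) = 0 := by
    nth_rewrite 1 [hPs]
    rw [smul_mul_assoc, ← h3, circleIntegral.integral_congr hs.le (g := h), hzero, smul_zero]
    exact fun z hz => hkey z ⟨hsub' (Metric.sphere_subset_closedBall hz),
      (sphere_subset_closedBall_diff_singleton hs hz).2⟩
  rw [mul_sub, mul_one, sub_eq_zero] at h4
  exact h4.symm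

end UnboundedOp

namespace ComplexBanachLattice

/-! ### Real and imaginary parts in a complex Banach lattice -/

variable {F E : Type*} [NormedAddCommGroup F] [NormedSpace ℝ F] [Lattice F]
  [NormedAddCommGroup E] [NormedSpace ℂ E] [ComplexBanachLattice F E]

/-- The decomposition `E = F + iF`, as a real linear equivalence. -/
noncomputable def complexify (F E : Type*) [NormedAddCommGroup F] [NormedSpace ℝ F] [Lattice F]
    [NormedAddCommGroup E] [NormedSpace ℂ E] [ComplexBanachLattice F E] : (F × F) ≃ₗ[ℝ] E :=
  LinearEquiv.ofBijective
    { toFun := fun p => ofReal p.1 + I • ofReal p.2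
      map_add' := fun p q => by
        simp only [Prod.fst_add, Prod.snd_add, map_add, smul_add]
        abel
      map_smul' := fun c p => by
        simp only [Prod.smul_fst, Prod.smul_snd, map_smul, RingHom.id_apply, smul_add]
        rw [smul_comm I c] }
    (by
      rw [Function.bijective_iff_existsUnique]
      intro z
      obtain ⟨p, hp, hunique⟩ := existsUnique_re_im (F := F) z
      exact ⟨p, hp.symm, fun q hq => hunique q hq.symm⟩)

/-- The real part of a vector. -/
noncomputable def rePart : E →ₗ[ℝ] F :=
  LinearMap.fst ℝ F F ∘ₗ (complexify F E).symm.toLinearMap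

/-- The imaginary part of a vector. -/
noncomputable def imPart : E →ₗ[ℝ] F :=
  LinearMap.snd ℝ F F ∘ₗ (complexify F E).symm.toLinearMap

theorem rePart_add_imPart (z : E) :
    ofReal (rePart z : F) + I • ofReal (imPart z : F) = z :=
  (complexify F E).apply_symm_apply z

@[simp]
theorem rePart_ofReal (x : F) : rePart (ofReal x : E) = x := by
  have h : (ofReal x : E) = complexify F E (x, 0) := by simp [complexify]
  simp [rePart, h]

theorem ofReal_injective : Function.Injective (ofReal : F → E) :=
  Function.LeftInverse.injective rePart_ofReal

theorem isLUB_modulus_parts (z : E) :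
    IsLUB (range fun θ : ℝ => Real.cos θ • (rePart z : F) + Real.sin θ • imPart z)
      (modulus z) := by
  have := isLUB_modulus (E := E) (rePart z : F) (imPart z)
  rwa [rePart_add_imPart] at this

/-- Take `θ = 0` and `θ = π` in the supremum that defines the modulus. -/
theorem abs_rePart_le_modulus (z : E) : |(rePart z : F)| ≤ modulus z := by
  have h := (isLUB_modulus_parts (F := F) z).1
  refine sup_le ?_ ?_
  · simpa using h ⟨0, rfl⟩
  · simpa using h ⟨Real.pi, rfl⟩

/-- Take `θ = ± π / 2` in the supremum that defines the modulus. -/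
theorem abs_imPart_le_modulus (z : E) : |(imPart z : F)| ≤ modulus z := by
  have h := (isLUB_modulus_parts (F := F) z).1
  refine sup_le ?_ ?_
  · simpa using h ⟨Real.pi / 2, rfl⟩
  · simpa using h ⟨-(Real.pi / 2), rfl⟩

theorem modulus_ofReal [IsOrderedAddMonoid F] [IsOrderedModule ℝ F] (x : F) :
    modulus (ofReal x : E) = |x| := by
  have h := isLUB_modulus (E := E) x 0
  simp only [map_zero, smul_zero, add_zero] at h
  refine h.unique ⟨?_, fun b hb => sup_le ?_ ?_⟩
  · rintro _ ⟨θ, rfl⟩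
    have hx : ∀ c : ℝ, 0 ≤ c → c ≤ 1 → ∀ y : F, y ≤ |x| → c • y ≤ |x| := fun c h0 h1 y hy =>
      (smul_le_smul_of_nonneg_left hy h0).trans <| by
        simpa using smul_le_smul_of_nonneg_right h1 (abs_nonneg x)
    simp only
    rcases le_total 0 (Real.cos θ) with h0 | h0
    · exact hx _ h0 (Real.cos_le_one θ) _ (le_abs_self x)
    · rw [← neg_smul_neg]
      exact hx _ (neg_nonneg.2 h0) (neg_le.1 (Real.neg_one_le_cos θ)) _ (neg_le_abs x)
  · simpa using hb ⟨0, rfl⟩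
  · simpa using hb ⟨Real.pi, rfl⟩

theorem norm_ofReal [IsOrderedAddMonoid F] [IsOrderedModule ℝ F] [HasSolidNorm F] (x : F) :
    ‖(ofReal x : E)‖ = ‖x‖ := by
  rw [norm_eq (F := F), modulus_ofReal, norm_abs_eq_norm]

theorem norm_rePart_le [HasSolidNorm F] (z : E) : ‖(rePart z : F)‖ ≤ ‖z‖ := by
  rw [norm_eq (F := F) z]
  exact norm_le_norm_of_abs_le_abs ((abs_rePart_le_modulus z).trans (le_abs_self _))

theorem continuous_ofReal [IsOrderedAddMonoid F] [IsOrderedModule ℝ F] [HasSolidNorm F] :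
    Continuous (ofReal : F → E) :=
  AddMonoidHomClass.continuous_of_bound ofReal 1 fun x => by rw [norm_ofReal, one_mul]

theorem continuous_rePart [HasSolidNorm F] : Continuous (rePart : E → F) :=
  AddMonoidHomClass.continuous_of_bound rePart 1 fun x => by
    rw [one_mul]
    exact norm_rePart_le x

theorem exists_pos [IsOrderedAddMonoid F] [Nontrivial E] : ∃ x : F, 0 < x := by
  obtain ⟨z, hz⟩ := exists_ne (0 : E)
  have hm : (modulus z : F) ≠ 0 := fun h0 => hz <| by
    rw [← norm_eq_zero, norm_eq (F := F), h0, norm_zero]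
  exact ⟨_, ((abs_nonneg _).trans (abs_rePart_le_modulus z)).lt_of_ne' hm⟩

/-- A quasi-interior point of a nonzero space is nonzero, since the ideal `E_0` is trivial. -/
theorem IsQuasiInterior.pos [IsOrderedAddMonoid F] [Nontrivial E] {u : F}
    (hu : IsQuasiInterior E u) : 0 < u := by
  refine hu.1.lt_of_ne' fun h0 => ?_
  have hsub : principalIdeal E u ⊆ {0} := by
    rintro f ⟨c, -, hc⟩
    rw [h0, smul_zero] at hc
    have : (modulus f : F) = 0 :=
      le_antisymm hc ((abs_nonneg _).trans (abs_rePart_le_modulus f))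
    rw [mem_singleton_iff, ← norm_eq_zero, norm_eq (F := F), this, norm_zero]
  obtain ⟨z, hz⟩ := exists_ne (0 : E)
  exact hz (closure_minimal hsub isClosed_singleton (hu.2 z))

theorem StronglyPositive.exists_pos [IsOrderedModule ℝ F] {u : F} (hu : 0 < u) {f : E}
    (h : StronglyPositive u f) :
    ∃ x : F, ofReal x = f ∧ 0 < x ∧ ∃ ε : ℝ, 0 < ε ∧ ε • u ≤ x := by
  obtain ⟨x, hx, -, ε, hε, hle⟩ := h
  exact ⟨x, hx, ((smul_nonneg hε.le hu.le).lt_of_ne' (smul_ne_zero hε.ne' hu.ne')).trans_le hle,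
    ε, hε, hle⟩

theorem StronglyPositive.smul [IsOrderedModule ℝ F] {u : F} {f : E}
    (h : StronglyPositive u f) {c : ℝ} (hc : 0 < c) :
    StronglyPositive u (c • f) := by
  obtain ⟨x, rfl, hx, ε, hε, hle⟩ := h
  refine ⟨c • x, map_smul _ _ _, smul_nonneg hc.le hx, c * ε, mul_pos hc hε, ?_⟩
  rw [mul_smul]
  exact smul_le_smul_of_nonneg_left hle hc.le

/-! ### Positive operators -/

variable (F) in
/-- A bounded operator on `E` is positive if it maps the positive cone to itself. -/
def OpPositive (T : E →L[ℂ] E) : Prop :=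
  ∀ x : F, 0 ≤ x → ∃ y : F, 0 ≤ y ∧ ofReal y = T (ofReal x)

theorem OpStronglyPositive.opPositive {u : F} {T : E →L[ℂ] E} (h : OpStronglyPositive u T) :
    OpPositive F T := by
  intro x hx
  rcases hx.eq_or_lt with rfl | hx
  · exact ⟨0, le_rfl, by simp⟩
  · obtain ⟨y, hy, hy0, -⟩ := h x hx
    exact ⟨y, hy0, hy⟩

/-- The action of an operator on the real part, `x ↦ Re (T x)`. For a positive operator it is the
restriction of `T` to `F`. -/
noncomputable def realAction (T : E →L[ℂ] E) : F →ₗ[ℝ] F :=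
  rePart ∘ₗ (T : E →ₗ[ℂ] E).restrictScalars ℝ ∘ₗ ofReal

theorem realAction_eq_of_ofReal_eq {T : E →L[ℂ] E} {x y : F} (h : ofReal y = T (ofReal x)) :
    realAction T x = y := by
  simp [realAction, ← h]

namespace OpPositive

variable {T : E →L[ℂ] E}

theorem realAction_nonneg (hT : OpPositive F T) {x : F} (hx : 0 ≤ x) : 0 ≤ realAction T x := by
  obtain ⟨y, hy, h⟩ := hT x hx
  rwa [realAction_eq_of_ofReal_eq h]

variable [IsOrderedAddMonoid F]

theorem ofReal_realAction (hT : OpPositive F T) (x : F) :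
    ofReal (realAction T x : F) = T (ofReal x) := by
  have h : ∀ y : F, 0 ≤ y → ofReal (realAction T y : F) = T (ofReal y) := fun y hy => by
    obtain ⟨z, -, hz⟩ := hT y hy
    rw [realAction_eq_of_ofReal_eq hz, hz]
  rw [← posPart_sub_negPart x]
  simp only [map_sub, h _ (posPart_nonneg x), h _ (negPart_nonneg x)]

theorem realAction_mono (hT : OpPositive F T) : Monotone (realAction T : F → F) := fun x y h => by
  have := hT.realAction_nonneg (sub_nonneg.2 h)
  rwa [map_sub, sub_nonneg] at this

theorem abs_realAction_le (hT : OpPositive F T) (x : F) : |realAction T x| ≤ realAction T |x| := by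
  refine sup_le (hT.realAction_mono (le_abs_self x)) ?_
  rw [← map_neg]
  exact hT.realAction_mono (neg_le_abs x)

theorem apply_eq (hT : OpPositive F T) (z : E) :
    T z = ofReal (realAction T (rePart z) : F) + I • ofReal (realAction T (imPart z) : F) := by
  conv_lhs => rw [← rePart_add_imPart (F := F) z]
  rw [map_add, map_smul, hT.ofReal_realAction, hT.ofReal_realAction]

/-- A positive operator that vanishes at a quasi-interior point `u` vanishes on the dense ideal
`E_u`, hence everywhere. -/
theorem eq_zero_of_realAction_eq_zero (hT : OpPositive F T) {u : F} (hu : IsQuasiInterior E u)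
    (h0 : realAction T u = 0) : T = 0 := by
  have hx : ∀ (x : F) (c : ℝ), |x| ≤ c • u → realAction T x = 0 := fun x c hc => by
    have h := (hT.abs_realAction_le x).trans (hT.realAction_mono hc)
    rw [map_smul, h0, smul_zero] at h
    exact le_antisymm ((le_abs_self _).trans h) (neg_nonpos.1 ((neg_le_abs _).trans h))
  refine ContinuousLinearMap.ext fun z =>
    congrFun (Continuous.ext_on hu.2 T.continuous continuous_zero fun f hf => ?_) z
  obtain ⟨c, -, hc⟩ := hf
  rw [hT.apply_eq, hx _ c ((abs_rePart_le_modulus f).trans hc),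
    hx _ c ((abs_imPart_le_modulus f).trans hc)]
  simp

end OpPositive

variable [IsOrderedAddMonoid F] [IsOrderedModule ℝ F] [HasSolidNorm F]

/-- The positive cone is closed, so that strong limits of positive operators are positive. -/
theorem opPositive_of_tendsto {ι : Type*} {l : Filter ι} [l.NeBot] {S : ι → E →L[ℂ] E}
    {T : E →L[ℂ] E} (hT : Tendsto S l (𝓝 T))
    (hS : ∀ x : F, 0 < x → ∀ᶠ i in l, ∃ y : F, 0 ≤ y ∧ ofReal y = S i (ofReal x)) :
    OpPositive F T := by
  intro x hx
  rcases hx.eq_or_lt with rfl | hx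
  · exact ⟨0, le_rfl, by simp⟩
  have hlim : Tendsto (fun i => S i (ofReal x)) l (𝓝 (T (ofReal x))) :=
    ((ContinuousLinearMap.apply ℂ E (ofReal x : E)).continuous.tendsto T).comp hT
  have hre : Tendsto (fun i => (rePart (S i (ofReal x)) : F)) l (𝓝 (rePart (T (ofReal x)))) :=
    (continuous_rePart.tendsto _).comp hlim
  refine ⟨rePart (T (ofReal x)), ge_of_tendsto hre ?_,
    tendsto_nhds_unique ((continuous_ofReal.tendsto _).comp hre) (hlim.congr' ?_)⟩
  · filter_upwards [hS x hx] with i ⟨y, hy, hyS⟩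
    rwa [← hyS, rePart_ofReal]
  · filter_upwards [hS x hx] with i ⟨y, hy, hyS⟩
    simp [← hyS]

end ComplexBanachLattice

namespace ComplexBanachLattice

variable {F E : Type*} [NormedAddCommGroup F] [NormedSpace ℝ F] [Lattice F]
  [IsOrderedAddMonoid F] [IsOrderedModule ℝ F]
  [NormedAddCommGroup E] [NormedSpace ℂ E] [ComplexBanachLattice F E]

/-! ### Leading coefficients of eventually strongly positive families -/

/-- If `S(t)` is individually eventually strongly positive as `t ↓ 0` and behaves like a resolvent
with leading coefficient `Q` of order `m + 1`, then `Q ≫ 0` and the order is one. A nonzero vector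
`Q x` with `x ≥ 0` is an eigenvector of `S(t)`, hence `≫ 0`; in particular `Q u ≫ 0`, and then
`Q x = t Q S(t) x` dominates a positive multiple of `Q u`. If the order exceeded one then `Q² = 0`,
contradicting `Q ≫ 0`. -/
theorem opStronglyPositive_of_tendsto [HasSolidNorm F] [Nontrivial E] {u : F}
    (hu : IsQuasiInterior E u)
    {S : ℝ → E →L[ℂ] E} {Q : E →L[ℂ] E} {m : ℕ} (hQ0 : Q ≠ 0)
    (hlim : Tendsto (fun t : ℝ => ((t ^ (m + 1) : ℝ) : ℂ) • S t) (𝓝[>] 0) (𝓝 Q))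
    (hSQ : ∀ᶠ t : ℝ in 𝓝[>] 0, (t : ℂ) • (S t * Q) = Q)
    (hQS : ∀ᶠ t : ℝ in 𝓝[>] 0, (t : ℂ) • (Q * S t) = Q)
    (hS : ∀ x : F, 0 < x → ∀ᶠ t : ℝ in 𝓝[>] 0, StronglyPositive u (S t (ofReal x))) :
    OpStronglyPositive u Q ∧ m = 0 := by
  have hu0 := hu.pos
  have hpos : OpPositive F Q := by
    refine opPositive_of_tendsto hlim fun x hx => ?_
    filter_upwards [hS x hx, self_mem_nhdsWithin] with t ht ht0
    obtain ⟨y, hy, hy0, -⟩ := ht.smul (pow_pos (mem_Ioi.1 ht0) (m + 1))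
    exact ⟨y, hy0, by rw [hy, smul_apply, Complex.coe_smul]⟩
  have hvec : ∀ x : F, 0 ≤ x → realAction Q x ≠ 0 → StronglyPositive u (Q (ofReal x)) := by
    intro x hx hne
    have hy : 0 < realAction Q x := (hpos.realAction_nonneg hx).lt_of_ne' hne
    obtain ⟨t, ht, hSt, ht0⟩ := ((hS _ hy).and (hSQ.and self_mem_nhdsWithin)).exists
    have heq := congr($hSt (ofReal x))
    rw [smul_apply, Complex.coe_smul, ContinuousLinearMap.mul_def,
      ContinuousLinearMap.comp_apply, ← hpos.ofReal_realAction] at heq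
    rw [← hpos.ofReal_realAction, ← heq]
    exact ht.smul ht0
  have hQu : realAction Q u ≠ 0 := fun h0 => hQ0 (hpos.eq_zero_of_realAction_eq_zero hu h0)
  obtain ⟨y, hy, -, δ, hδ, hδy⟩ := hvec u hu.1 hQu
  rw [← realAction_eq_of_ofReal_eq hy] at hδy
  have hstrong : OpStronglyPositive u Q := by
    intro x hx
    obtain ⟨t, ⟨y, hy, -, ε, hε, hεy⟩, hQSt, ht0⟩ :=
      ((hS x hx).and (hQS.and self_mem_nhdsWithin)).exists
    have heq := congr($hQSt (ofReal x))
    rw [smul_apply, Complex.coe_smul, ContinuousLinearMap.mul_def,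
      ContinuousLinearMap.comp_apply, ← hy, ← hpos.ofReal_realAction] at heq
    rw [← heq]
    have hle : (ε * δ) • u ≤ realAction Q y :=
      calc (ε * δ) • u = ε • δ • u := mul_smul _ _ _
        _ ≤ ε • realAction Q u := smul_le_smul_of_nonneg_left hδy hε.le
        _ = realAction Q (ε • u) := (map_smul _ _ _).symm
        _ ≤ realAction Q y := hpos.realAction_mono hεy
    exact StronglyPositive.smul ⟨_, rfl, (smul_nonneg (by positivity) hu.1).trans hle,
      ε * δ, by positivity, hle⟩ ht0
  refine ⟨hstrong, by_contra fun hm => ?_⟩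
  -- `t ^ (m + 1) S(t) Q = t ^ m Q` tends to zero, while the left-hand side tends to `Q²`.
  have hsq : Q * Q = 0 := by
    have hpow : Tendsto (fun t : ℝ => ((t ^ m : ℝ) : ℂ)) (𝓝[>] 0) (𝓝 0) := by
      have : Continuous fun t : ℝ => ((t ^ m : ℝ) : ℂ) := by fun_prop
      simpa [hm] using (this.tendsto 0).mono_left nhdsWithin_le_nhds
    have h0 := hpow.smul_const Q
    rw [zero_smul] at h0
    refine tendsto_nhds_unique (hlim.mul_const Q) (h0.congr' ?_)
    filter_upwards [hSQ] with t ht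
    nth_rewrite 1 [← ht]
    rw [smul_smul, smul_mul_assoc, pow_succ, Complex.ofReal_mul]
  obtain ⟨y, hy, hy0, -⟩ := (hstrong u hu0).exists_pos hu0
  obtain ⟨y', hy', hy'0, -⟩ := (hstrong y hy0).exists_pos hu0
  have h0 : Q (Q (ofReal u)) = 0 := congr($hsq (ofReal u))
  rw [← hy, ← hy', ← map_zero (ofReal : F →ₗ[ℝ] E)] at h0
  exact hy'0.ne' (ofReal_injective h0)

/-! ### Fixed vectors of a strongly positive projection -/

section FixedSpace

variable {p : F →ₗ[ℝ] F} {u : F}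

/-- The fixed space of a strongly positive projection is totally ordered: it is a sublattice, and
two of its vectors cannot be positive and disjoint, as both dominate a multiple of `u`. -/
theorem nonneg_or_nonpos_of_fixed (hp : Monotone p) (hidem : ∀ x, p (p x) = p x) (hu : 0 < u)
    (hstrong : ∀ x, 0 < x → ∃ ε : ℝ, 0 < ε ∧ ε • u ≤ p x) {x : F} (hx : p x = x) :
    0 ≤ x ∨ x ≤ 0 := by
  have hεu : ∀ ε : ℝ, 0 < ε → ¬ ε • u ≤ 0 := fun ε hε hle =>
    smul_ne_zero hε.ne' hu.ne' (le_antisymm hle (smul_nonneg hε.le hu.le))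
  -- `p y⁺ - y⁺ ≥ 0` is annihilated by `p`, which strong positivity allows only for the zero vector.
  have hpp : ∀ y, p y = y → p y⁺ = y⁺ := by
    intro y hy
    have hle : y⁺ ≤ p y⁺ := by
      refine sup_le ?_ ?_
      · rw [← hy]
        exact (hp (le_posPart y)).trans_eq (by rw [hy])
      · simpa using hp (posPart_nonneg y)
    by_contra hne
    obtain ⟨ε, hε, hle0⟩ := hstrong _ (sub_pos.2 (hle.lt_of_ne' hne))
    rw [map_sub, hidem, sub_self] at hle0
    exact hεu ε hε hle0
  have hneg : p x⁻ = x⁻ := by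
    rw [← posPart_neg]
    exact hpp _ (by rw [map_neg, hx])
  by_contra! hcon
  obtain ⟨ε, hε, h1⟩ := hstrong x⁺ ((posPart_nonneg x).lt_of_ne' fun h =>
    hcon.2 (posPart_eq_zero.1 h))
  obtain ⟨δ, hδ, h2⟩ := hstrong x⁻ ((negPart_nonneg x).lt_of_ne' fun h =>
    hcon.1 (negPart_eq_zero.1 h))
  rw [hpp x hx] at h1
  rw [hneg] at h2
  refine hεu (min ε δ) (lt_min hε hδ) ?_
  rw [← posPart_inf_negPart_eq_zero x]
  exact le_inf ((smul_le_smul_of_nonneg_right (min_le_left _ _) hu.le).trans h1)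
    ((smul_le_smul_of_nonneg_right (min_le_right _ _) hu.le).trans h2)

/-- A totally ordered Archimedean space is at most one-dimensional: the line `ℝ` is the union of the
closed sets `{t | x ≤ t v}` and `{t | t v ≤ x}`, which therefore meet. -/
theorem exists_eq_smul_of_fixed [HasSolidNorm F] (hp : Monotone p)
    (hidem : ∀ x, p (p x) = p x) (hu : 0 < u)
    (hstrong : ∀ x, 0 < x → ∃ ε : ℝ, 0 < ε ∧ ε • u ≤ p x) {v : F} (hv : p v = v) (hv0 : 0 < v)
    {x : F} (hx : p x = x) : ∃ c : ℝ, x = c • v := by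
  have htotal : ∀ y, p y = y → ∀ t : ℝ, y ≤ t • v ∨ t • v ≤ y := fun y hy t => by
    have := nonneg_or_nonpos_of_fixed hp hidem hu hstrong (x := y - t • v)
      (by rw [map_sub, map_smul, hy, hv])
    rwa [sub_nonneg, sub_nonpos, or_comm] at this
  have hbdd : ∀ y, p y = y → ∃ t : ℝ, y ≤ t • v := by
    intro y hy
    by_contra! hcon
    have hle : ∀ t : ℝ, t • v ≤ y := fun t => (htotal y hy t).resolve_left (hcon t)
    have hlim : Tendsto (fun t : ℝ => t⁻¹ • y) atTop (𝓝 0) := by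
      simpa using (tendsto_inv_atTop_zero (𝕜 := ℝ)).smul_const y
    refine hv0.not_ge (ge_of_tendsto hlim ?_)
    filter_upwards [eventually_gt_atTop 0] with t ht
    simpa [smul_smul, inv_mul_cancel₀ ht.ne'] using
      smul_le_smul_of_nonneg_left (hle t) (inv_pos.2 ht).le
  obtain ⟨a, ha⟩ := hbdd x hx
  obtain ⟨b, hb⟩ := hbdd (-x) (by rw [map_neg, hx])
  have hcont : Continuous fun t : ℝ => t • v := by fun_prop
  obtain ⟨c, -, hc1, hc2⟩ := isPreconnected_closed_iff.1 (isPreconnected_univ (α := ℝ))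
    {t | x ≤ t • v} {t | t • v ≤ x} (isClosed_le continuous_const hcont)
    (isClosed_le hcont continuous_const) (fun t _ => htotal x hx t) ⟨a, trivial, ha⟩
    ⟨-b, trivial, by
      change -b • v ≤ x
      rw [neg_smul]
      exact neg_le.1 hb⟩
  exact ⟨c, le_antisymm hc1 hc2⟩

end FixedSpace

end ComplexBanachLattice

namespace UnboundedOp

open ComplexBanachLattice

variable {F E : Type*} [NormedAddCommGroup F] [NormedSpace ℝ F] [Lattice F]
  [IsOrderedModule ℝ F]
  [NormedAddCommGroup E] [NormedSpace ℂ E] [CompleteSpace E] [ComplexBanachLattice F E]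
  {A : E →ₗ.[ℂ] E} {u : F} {l₀ : ℝ} {P : E →L[ℂ] E}

/-! ### Strong positivity from the Perron–Frobenius property -/

/-- The strictly positive dual eigenvector excludes a pole of higher order, so that `P` is the
leading coefficient, whose range lies in the one-dimensional eigenspace. -/
theorem PerronFrobenius.opStronglyPositive (h : PerronFrobenius A u l₀)
    (hA : Dense (A.domain : Set E)) (hu : 0 < u)
    (hpole : IsPoleOfResolvent A (l₀ : ℂ)) (hP : IsSpectralProjection A (l₀ : ℂ) P) :
    OpStronglyPositive u P := by
  obtain ⟨hfin, ⟨v, hv, hvpos⟩, φ, hφ, hφpos⟩ := h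
  rw [mem_eigenspace_dual_iff hA] at hφ
  obtain ⟨m, Q, hQ0, hQ⟩ := hpole.exists_leadingCoeff
  have hρ := hpole.1
  obtain ⟨y, hy, hy0, -⟩ := hvpos.exists_pos hu
  obtain ⟨r, hr, hφv⟩ := hφpos y hy0
  rw [hy] at hφv
  have hr0 : (r : ℂ) ≠ 0 := by exact_mod_cast hr.ne'
  have hv0 : (⟨v, hv⟩ : eigenspace A (l₀ : ℂ)) ≠ 0 := fun h0 => by
    have hv' : v = 0 := congrArg Subtype.val h0
    rw [hv'] at hφv
    exact hr0 (by simpa using hφv.symm)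
  have hspan : ∀ f, ∃ c : ℂ, c • v = Q f := fun f => by
    obtain ⟨c, hc⟩ := (finrank_eq_one_iff_of_nonzero' _ hv0).1 hfin
      ⟨Q f, leadingCoeff_mem_eigenspace hρ hQ f⟩
    exact ⟨c, Subtype.ext_iff.1 hc⟩
  have hφR : ∀ z ∈ resolventSet A, ∀ f, (z - l₀) * φ (resolvent A z f) = φ f := by
    intro z hz f
    obtain ⟨hd, hf⟩ := (isResolventAt_resolvent hz).1 f
    have h1 := congrArg φ hf
    rw [map_sub, map_smul, hφ ⟨_, hd⟩, smul_eq_mul, smul_eq_mul] at h1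
    rw [sub_mul]
    exact h1
  -- `(z - l₀) ^ (m + 1) φ(R(z) f) = (z - l₀) ^ m φ(f)`, since `φ` is a dual eigenvector.
  have hφQ : ∀ f, Tendsto (fun z : ℂ => (z - l₀) ^ m * φ f) (𝓝[≠] (l₀ : ℂ)) (𝓝 (φ (Q f))) := by
    intro f
    have h1 : Tendsto (fun z : ℂ => φ (((z - l₀) ^ (m + 1) • resolvent A z) f)) (𝓝[≠] (l₀ : ℂ))
        (𝓝 (φ (Q f))) :=
      ((φ.continuous.comp (ContinuousLinearMap.apply ℂ E f).continuous).tendsto Q).comp hQ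
    refine h1.congr' ?_
    filter_upwards [hρ] with z hz
    rw [smul_apply, map_smul, smul_eq_mul, ← hφR z hz f, pow_succ, mul_assoc]
  have hlim : ∀ f, φ (Q f) = 0 ^ m * φ f := fun f => by
    have hcont : Continuous fun z : ℂ => (z - l₀) ^ m * φ f := by fun_prop
    refine tendsto_nhds_unique (hφQ f) ?_
    simpa using (hcont.tendsto (l₀ : ℂ)).mono_left nhdsWithin_le_nhds
  have hm : m = 0 := by
    by_contra hm
    refine hQ0 (ContinuousLinearMap.ext fun f => ?_)
    obtain ⟨c, hc⟩ := hspan f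
    have h1 := hlim f
    rw [zero_pow hm, zero_mul, ← hc, map_smul, hφv, smul_eq_mul, mul_eq_zero] at h1
    rw [← hc, h1.resolve_right hr0, zero_smul, zero_apply]
  subst hm
  simp only [zero_add, pow_one] at hQ
  rw [hP.eq_of_tendsto hQ]
  intro x hx
  obtain ⟨r', hr', hφx⟩ := hφpos x hx
  obtain ⟨c, hc⟩ := hspan (ofReal x)
  have h1 := hlim (ofReal x)
  rw [pow_zero, one_mul, hφx, ← hc, map_smul, hφv, smul_eq_mul] at h1
  have hcr : c = ((r' / r : ℝ) : ℂ) := by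
    rw [Complex.ofReal_div, eq_div_iff hr0, h1]
  rw [← hc, hcr, Complex.coe_smul]
  exact hvpos.smul (div_pos hr' hr)

/-! ### Strong positivity from eventual positivity of the resolvent -/

variable [IsOrderedAddMonoid F] [HasSolidNorm F]

/-- Eventual strong positivity (`s = 1`) or negativity (`s = -1`) of the resolvent at a pole makes
the spectral projection strongly positive. -/
theorem opStronglyPositive_of_sign (hu : IsQuasiInterior E u) (hpole : IsPoleOfResolvent A (l₀ : ℂ))
    (hP : IsSpectralProjection A (l₀ : ℂ) P) {s : ℝ} (hs : s * s = 1)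
    (h : ∀ x : F, 0 < x → ∀ᶠ t : ℝ in 𝓝[>] 0,
      StronglyPositive u (((s : ℂ) • resolvent A ((l₀ + s * t : ℝ) : ℂ)) (ofReal x))) :
    OpStronglyPositive u P := by
  have := hpole.nontrivial
  obtain ⟨m, Q, hQ0, hQ⟩ := hpole.exists_leadingCoeff
  have hρ := hpole.1
  have hs0 : s ≠ 0 := left_ne_zero_of_mul_eq_one hs
  have hsC : (s : ℂ) * s = 1 := by exact_mod_cast hs
  have hs0C : (s : ℂ) ≠ 0 := by exact_mod_cast hs0
  have hz : Tendsto (fun t : ℝ => ((l₀ + s * t : ℝ) : ℂ)) (𝓝[>] 0) (𝓝[≠] (l₀ : ℂ)) := by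
    refine tendsto_nhdsWithin_iff.2 ⟨?_, ?_⟩
    · have : Continuous fun t : ℝ => ((l₀ + s * t : ℝ) : ℂ) := by fun_prop
      simpa using (this.tendsto 0).mono_left nhdsWithin_le_nhds
    · filter_upwards [self_mem_nhdsWithin] with t ht
      have : s * t ≠ 0 := mul_ne_zero hs0 (mem_Ioi.1 ht).ne'
      simpa [Complex.ofReal_inj] using this
  have hsub : ∀ t : ℝ, ((l₀ + s * t : ℝ) : ℂ) - l₀ = s * t := fun t => by push_cast; ring
  -- With `z = l₀ + s t`, `s² = 1` one has `t ^ (m + 1) s = s ^ (m + 2) (z - l₀) ^ (m + 1)`, so the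
  -- leading coefficient of `s R(l₀ + s t)` in `t` is `s ^ (m + 2) Q`, which is `Q` for `m = 0`.
  have key := opStronglyPositive_of_tendsto hu (m := m) (Q := ((s : ℂ) ^ (m + 2)) • Q)
    (smul_ne_zero (pow_ne_zero _ hs0C) hQ0) ?_ ?_ ?_ h
  · obtain ⟨hpos, rfl⟩ := key
    rw [zero_add, pow_two, hsC, one_smul] at hpos
    simp only [zero_add, pow_one] at hQ
    rwa [hP.eq_of_tendsto hQ]
  · refine ((hQ.comp hz).const_smul ((s : ℂ) ^ (m + 2))).congr fun t => ?_
    simp only [Function.comp, hsub, smul_smul]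
    congr 1
    push_cast
    calc (s : ℂ) ^ (m + 2) * (s * t) ^ (m + 1) = ((s : ℂ) * s) ^ (m + 1) * (t ^ (m + 1) * s) := by
          ring
      _ = _ := by rw [hsC, one_pow, one_mul]
  · filter_upwards [hz.eventually hρ] with t ht
    have := resolvent_mul_leadingCoeff hρ hQ ht
    rw [hsub] at this
    rw [mul_smul_comm, smul_mul_assoc, smul_comm, smul_smul, smul_smul, mul_assoc,
      mul_comm (t : ℂ), mul_smul, this]
  · filter_upwards [hz.eventually hρ] with t ht
    have := leadingCoeff_mul_resolvent hρ hQ ht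
    rw [hsub] at this
    rw [smul_mul_assoc, mul_smul_comm, smul_comm, smul_smul, smul_smul, mul_assoc,
      mul_comm (t : ℂ), mul_smul, this]

theorem ResolventEventuallyStronglyPositive.opStronglyPositive
    (h : ResolventEventuallyStronglyPositive A u l₀) (hu : IsQuasiInterior E u)
    (hpole : IsPoleOfResolvent A (l₀ : ℂ)) (hP : IsSpectralProjection A (l₀ : ℂ) P) :
    OpStronglyPositive u P := by
  refine opStronglyPositive_of_sign hu hpole hP (one_mul 1) fun x hx => ?_
  obtain ⟨l₁, hl, hR⟩ := h x hx
  filter_upwards [Ioc_mem_nhdsGT (sub_pos.2 hl)] with t ht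
  simpa using (hR (l₀ + t) ⟨by linarith [ht.1], by linarith [ht.2]⟩).2

theorem ResolventEventuallyStronglyNegative.opStronglyPositive
    (h : ResolventEventuallyStronglyNegative A u l₀) (hu : IsQuasiInterior E u)
    (hpole : IsPoleOfResolvent A (l₀ : ℂ)) (hP : IsSpectralProjection A (l₀ : ℂ) P) :
    OpStronglyPositive u P := by
  refine opStronglyPositive_of_sign hu hpole hP (s := -1) (by norm_num) fun x hx => ?_
  obtain ⟨l₁, hl, hR⟩ := h x hx
  filter_upwards [Ioc_mem_nhdsGT (sub_pos.2 hl)] with t ht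
  simpa using (hR (l₀ + -1 * t) ⟨by linarith [ht.2], by linarith [ht.1]⟩).2

/-! ### The Perron–Frobenius property of a strongly positive spectral projection -/

/-- The range of a strongly positive spectral projection `P` is spanned by a single vector `v ≫ 0`,
and it contains the nonzero eigenspace, so the two coincide. Writing `P = φ ⊗ v` yields the strictly
positive functional `φ`, which is a dual eigenvector since `P` commutes with the resolvent. -/
theorem perronFrobenius_of_opStronglyPositive (h : OpStronglyPositive u P)
    (hA : Dense (A.domain : Set E)) (hu : 0 < u)
    (hpole : IsPoleOfResolvent A (l₀ : ℂ)) (hP : IsSpectralProjection A (l₀ : ℂ) P) :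
    PerronFrobenius A u l₀ := by
  have := hpole.nontrivial
  obtain ⟨m, Q, hQ0, hQ⟩ := hpole.exists_leadingCoeff
  have hρ := hpole.1
  have hpos := h.opPositive
  have hact : ∀ x : F, 0 < x → 0 < realAction P x ∧ ∃ ε : ℝ, 0 < ε ∧ ε • u ≤ realAction P x :=
    fun x hx => by
      obtain ⟨y, hy, hy0⟩ := (h x hx).exists_pos hu
      rwa [realAction_eq_of_ofReal_eq hy]
  have hidem : ∀ x : F, realAction P (realAction P x) = realAction P x := fun x => by
    refine realAction_eq_of_ofReal_eq ?_
    rw [hpos.ofReal_realAction]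
    exact congr($(hP.mul_self) (ofReal x)).symm
  obtain ⟨x₀, hx₀⟩ := exists_pos (F := F) (E := E)
  set v : F := realAction P x₀ with hv
  have hv0 : 0 < v := (hact x₀ hx₀).1
  have hreal : ∀ x : F, ∃ c : ℝ, realAction P x = c • v := fun x =>
    exists_eq_smul_of_fixed hpos.realAction_mono hidem hu (fun y hy => (hact y hy).2)
      (hidem x₀) hv0 (hidem x)
  have hrange : ∀ z : E, ∃ c : ℂ, P z = c • (ofReal v : E) := by
    intro z
    obtain ⟨a, ha⟩ := hreal (rePart z)
    obtain ⟨b, hb⟩ := hreal (imPart z)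
    refine ⟨a + I * b, ?_⟩
    rw [hpos.apply_eq, ha, hb, map_smul, map_smul, add_smul, mul_smul, Complex.coe_smul,
      Complex.coe_smul]
  have hvE : (ofReal v : E) ≠ 0 := fun h0 =>
    hv0.ne' (ofReal_injective (E := E) (h0.trans (map_zero _).symm))
  have hveig : (ofReal v : E) ∈ eigenspace A (l₀ : ℂ) := by
    obtain ⟨f, hf⟩ := DFunLike.ne_iff.1 hQ0
    have hQf := leadingCoeff_mem_eigenspace hρ hQ f
    obtain ⟨c, hc⟩ := hrange (Q f)
    rw [hP.apply_of_mem_eigenspace hQf] at hc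
    have hc0 : c ≠ 0 := fun h0 => hf (by rw [hc, h0, zero_smul, zero_apply])
    rw [← inv_smul_smul₀ hc0 (ofReal v : E), ← hc]
    exact Submodule.smul_mem _ _ hQf
  have heig : eigenspace A (l₀ : ℂ) = Submodule.span ℂ {(ofReal v : E)} := by
    refine le_antisymm (fun x hx => ?_) ((Submodule.span_singleton_le_iff_mem _ _).2 hveig)
    obtain ⟨c, hc⟩ := hrange x
    rw [hP.apply_of_mem_eigenspace hx] at hc
    exact Submodule.mem_span_singleton.2 ⟨c, hc.symm⟩
  have hPeig : ∀ f, P f ∈ eigenspace A (l₀ : ℂ) := fun f => by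
    obtain ⟨c, hc⟩ := hrange f
    rw [hc]
    exact Submodule.smul_mem _ _ hveig
  obtain ⟨ℓ, hℓ⟩ := SeparatingDual.exists_eq_one (R := ℂ) hvE
  refine ⟨by rw [heig, finrank_span_singleton hvE], ⟨ofReal v, hveig, ?_⟩, ℓ.comp P, ?_, ?_⟩
  · rw [hv, hpos.ofReal_realAction]
    exact h x₀ hx₀
  · rw [mem_eigenspace_dual_iff hA]
    intro x
    obtain ⟨w, hw⟩ := hρ.exists
    have hRx := (isResolventAt_resolvent hw).2 x
    have h1 := (mem_eigenspace_iff_resolvent hw).1 (hPeig (w • (x : E) - A x))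
    have h2 : resolvent A w (P (w • (x : E) - A x)) = P x := by
      exact congr($(hP.resolvent_mul_comm hw) (w • (x : E) - A x)).trans (congrArg P hRx)
    rw [h2, map_sub, map_smul, sub_smul] at h1
    have h3 := sub_right_injective h1
    rw [ContinuousLinearMap.comp_apply, ContinuousLinearMap.comp_apply, ← h3, map_smul]
  · intro x hx
    obtain ⟨c, hc⟩ := hreal x
    refine ⟨c, ?_, ?_⟩
    · by_contra! hc0
      have hlt := (hact x hx).1
      rw [hc] at hlt
      exact hlt.not_ge (smul_nonpos_of_nonpos_of_nonneg hc0 hv0.le)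
    · rw [ContinuousLinearMap.comp_apply, ← hpos.ofReal_realAction, hc, map_smul,
        ← Complex.coe_smul, map_smul, hℓ, smul_eq_mul, mul_one]

end UnboundedOp

theorem mainTheorem1 {F E : Type*}
    [NormedAddCommGroup F] [NormedSpace ℝ F] [Lattice F] [IsOrderedAddMonoid F]
    [IsOrderedModule ℝ F] [HasSolidNorm F] [CompleteSpace F]
    [NormedAddCommGroup E] [NormedSpace ℂ E] [CompleteSpace E] [ComplexBanachLattice F E]
    (A : E →ₗ.[ℂ] E) (hdense : Dense (A.domain : Set E)) (hreal : UnboundedOp.IsRealOp F A)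
    (u : F) (hu : ComplexBanachLattice.IsQuasiInterior E u)
    (l₀ : ℝ) (hspec : (l₀ : ℂ) ∈ UnboundedOp.spectrum A)
    (hpole : UnboundedOp.IsPoleOfResolvent A (l₀ : ℂ))
    (P : E →L[ℂ] E) (hP : UnboundedOp.IsSpectralProjection A (l₀ : ℂ) P) :
    ((UnboundedOp.ResolventEventuallyStronglyPositive A u l₀ ∨
        UnboundedOp.ResolventEventuallyStronglyNegative A u l₀) →
      ComplexBanachLattice.OpStronglyPositive u P) ∧
    (ComplexBanachLattice.OpStronglyPositive u P ↔ UnboundedOp.PerronFrobenius A u l₀) := by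
  have := hpole.nontrivial
  refine ⟨?_, fun h => ?_, fun h => h.opStronglyPositive hdense hu.pos hpole hP⟩
  · rintro (h | h)
    · exact h.opStronglyPositive hu hpole hP
    · exact h.opStronglyPositive hu hpole hP
  · exact UnboundedOp.perronFrobenius_of_opStronglyPositive h hdense hu.pos hpole hP
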